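/- **Setting.** Let $\mathbb H$ be the quaternions with the Euclidean scalar product $\langle\cdot,\cdot\rangle$ of $\mathbb R^4$. A *rank-4 lattice* is an additive subgroup $L=\mathbb Zv_1+\dots+\mathbb Zv_4\subset\mathbb H$ with $v_1,\dots,v_4$ linearly independent over $\mathbb R$; the ordered quadruple $(v_1,\dots,v_4)$ is then a *basis* of $L$, with *Gram matrix* $(\langle v_i,v_j\rangle)_{i,j}$. A function $f$ on an open subset $\Omega$ of $\mathbb H$ is *(slice) regular* if for every $I\in\mathbb H$ with $I^2=-1$ its restriction to $\Omega\cap(\mathbb R+I\mathbb R)$ is $C^1$ in $(x,y)$ and satisfies $\frac12\left(\frac{\partial}{\partial x}+I\frac{\partial}{\partial y}\right)f(x+Iy)=0$. A *quaternionic torus* is a quotient $\mathbb H/L$ with $L$ a rank-4 lattice, with the atlas given by the local inverses $(\pi|_U)^{-1}$ of the projection $\pi:\mathbb H\to\mathbb H/L$, where $U$ is open and $\pi|_U$ is injective. A continuous map between such tori is *regular* if all its expressions in these charts are slice regular. Two tori are *equivalent* if there is a biregular diffeomorphism between them, that is, a diffeomorphism which is regular together with its inverse. **Reduction.** Let $S$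 be the Gram matrix of a basis of a rank-4 lattice. A matrix $U\in GL(4,\mathbb Z)$ with rows $u_1,\dots,u_4$ is *produced by the Minkowski–Siegel reduction algorithm* from $S$ if: $u_1$ minimizes $u\,S\,{}^tu$ over all nonzero $u\in\mathbb Z^4$; for $k=2,3,4$, $u_k$ minimizes $u\,S\,{}^tu$ over all $u\in\mathbb Z^4$ for which some matrix in $GL(4,\mathbb Z)$ has first $k$ rows $u_1,\dots,u_{k-1},u$; and $u_k\,S\,{}^tu_{k+1}\ge 0$ for $k=1,2,3$. The matrix $R=U S\,{}^tU$ is then called a *reduced Gram matrix*; $\mathcal R$ is the set of all reduced Gram matrices, a subset of the 10-dimensional space of real symmetric $4\times4$ matrices, and its interior is taken in that space. A basis is *reduced* if its Gram matrix lies in $\mathcal R$, *tame* if it is reduced and its Gram matrix lies in the interior of $\mathcal R$, and *special* if it is reduced and its first vector is $1$. A *tame lattice* is a rank-4 lattice having a tame basis, and a *tame torus* is a quaternionic torus equivalent to $\mathbb H/L$ for some tame lattice $L$. Put $$\mathcal M=\{(v_2,v_3,v_4)\in\mathbb H^3:\ (1,v_2,v_3,v_4)\text{ is a special basis}\},$$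 $$\mathcal T=\{(v_2,v_3,v_4)\in\mathcal M:\ (1,v_2,v_3,v_4)\text{ is a tame basis}\}.$$ A point $(v_2,v_3,v_4)\in\mathcal M$ is a *(representative of the) modulus* of every quaternionic torus equivalent to $\mathbb H/(\mathbb Z+\mathbb Zv_2+\mathbb Zv_3+\mathbb Zv_4)$. **Theorem.** The set $\mathcal T\subset\mathcal M$ is a moduli space for the equivalence classes of tame tori. That is: every point of $\mathcal T$ is the modulus of a tame torus, namely $\mathbb H/(\mathbb Z+\mathbb Zv_2+\mathbb Zv_3+\mathbb Zv_4)$ is tame for every $(v_2,v_3,v_4)\in\mathcal T$; every tame torus has exactly one modulus in $\mathcal T$; and two tame tori are equivalent if and only if they have the same modulus in $\mathcal T$. -/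

import Mathlib

open scoped Quaternion

namespace QTorus

noncomputable section

/-! ### Slice regular functions -/

/-- The parametrization `(x, y) ↦ x + I y` of the slice `L_I = ℝ + I ℝ`. -/
def slice (I : ℍ) (z : ℝ × ℝ) : ℍ := (z.1 : ℍ) + I * (z.2 : ℍ)

/-- `f` is (slice) regular on the open set `Ω`: for every imaginary unit `I`, the restriction
`f_I` of `f` to `Ω ∩ L_I` is of class `C¹` and `(∂/∂x + I ∂/∂y) f_I = 0` there. -/
def SliceRegularOn (f : ℍ → ℍ) (Ω : Set ℍ) : Prop :=
  ∀ I : ℍ, I * I = -1 →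
    ContDiffOn ℝ 1 (f ∘ slice I) (slice I ⁻¹' Ω) ∧
    ∀ z ∈ slice I ⁻¹' Ω,
      (1 / 2 : ℝ) • (fderiv ℝ (f ∘ slice I) z (1, 0) + I * fderiv ℝ (f ∘ slice I) z (0, 1)) = 0

/-! ### Lattices and quaternionic tori -/

/-- The additive subgroup `ℤ v₁ + ℤ v₂ + ℤ v₃ + ℤ v₄` of `ℍ`. -/
def latticeOf (v : Fin 4 → ℍ) : AddSubgroup ℍ := AddSubgroup.closure (Set.range v)

/-- The (ordered) quadruple `v` is a basis of the rank-4 lattice `L`. -/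
def IsBasisOf (L : AddSubgroup ℍ) (v : Fin 4 → ℍ) : Prop :=
  LinearIndependent ℝ v ∧ latticeOf v = L

/-- `L` is generated by four `ℝ`-linearly independent quaternions. -/
def IsRankFourLattice (L : AddSubgroup ℍ) : Prop := ∃ v : Fin 4 → ℍ, IsBasisOf L v

/-- The torus `ℍ / L` (with the quotient topology). -/
abbrev Torus (L : AddSubgroup ℍ) : Type := ℍ ⧸ L

/-- The canonical projection `π : ℍ → ℍ / L`. -/
def proj (L : AddSubgroup ℍ) (q : ℍ) : Torus L := (q : ℍ ⧸ L)

/-- `U` is (the image of) a coordinate chart of `ℍ / L`: an open set on which `π` is injective,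
hence (`π` being continuous and open) a homeomorphism onto the open set `π(U)`. -/
def IsChartDomain (L : AddSubgroup ℍ) (U : Set ℍ) : Prop :=
  IsOpen U ∧ Set.InjOn (proj L) U

/-- The chart `(π|_U)⁻¹ : π(U) → U` (with irrelevant values off `π(U)`). -/
def chart (L : AddSubgroup ℍ) (U : Set ℍ) : Torus L → ℍ := Function.invFunOn (proj L) U

/-- The coordinate expression of `f : ℍ / L₁ → ℍ / L₂`, with target chart `(π₂|_V)⁻¹`. -/
def coordExpr {L₁ L₂ : AddSubgroup ℍ} (f : Torus L₁ → Torus L₂) (V : Set ℍ) : ℍ → ℍ :=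
  chart L₂ V ∘ f ∘ proj L₁

/-- The part of the chart domain `U` on which the coordinate expression is defined. -/
def coordDomain {L₁ L₂ : AddSubgroup ℍ} (f : Torus L₁ → Torus L₂) (U V : Set ℍ) : Set ℍ :=
  {q | q ∈ U ∧ f (proj L₁ q) ∈ proj L₂ '' V}

/-- `f` is a regular map of quaternionic tori: it is continuous and slice regular in charts. -/
def IsRegularMap {L₁ L₂ : AddSubgroup ℍ} (f : Torus L₁ → Torus L₂) : Prop :=
  Continuous f ∧ ∀ U V : Set ℍ, IsChartDomain L₁ U → IsChartDomain L₂ V →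
    SliceRegularOn (coordExpr f V) (coordDomain f U V)

/-- `f` is a smooth (`C^∞`, in the real sense) map: it is continuous and smooth in charts. -/
def IsSmoothMap {L₁ L₂ : AddSubgroup ℍ} (f : Torus L₁ → Torus L₂) : Prop :=
  Continuous f ∧ ∀ U V : Set ℍ, IsChartDomain L₁ U → IsChartDomain L₂ V →
    ContDiffOn ℝ (⊤ : ℕ∞) (coordExpr f V) (coordDomain f U V)

/-- The bijection `f` is a biregular diffeomorphism. -/
def IsBiregularDiffeo {L₁ L₂ : AddSubgroup ℍ} (f : Torus L₁ ≃ Torus L₂) : Prop :=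
  (IsSmoothMap f ∧ IsSmoothMap f.symm) ∧ (IsRegularMap f ∧ IsRegularMap f.symm)

/-- The quaternionic tori `ℍ / L₁` and `ℍ / L₂` are equivalent. -/
def EquivalentTori (L₁ L₂ : AddSubgroup ℍ) : Prop :=
  ∃ f : Torus L₁ ≃ Torus L₂, IsBiregularDiffeo f

/-! ### Minkowski-Siegel reduction -/

/-- Real symmetric `4 × 4` matrices, with the topology of `ℝ¹⁰`. -/
abbrev SymMat : Type := {A : Matrix (Fin 4) (Fin 4) ℝ // A.IsSymm}

/-- The Gram matrix `(⟨v_i, v_j⟩)` of four quaternions. -/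
def gramMat (v : Fin 4 → ℍ) : SymMat :=
  ⟨Matrix.of fun i j => inner ℝ (v i) (v j),
    Matrix.IsSymm.ext fun i j => real_inner_comm (v i) (v j)⟩

/-- The set of Gram matrices of (bases of) rank-4 lattices of `ℍ`. -/
def gramMatrices : Set SymMat := {S | ∃ v : Fin 4 → ℍ, LinearIndependent ℝ v ∧ S = gramMat v}

/-- `u S ᵗw` for integer row vectors `u`, `w`. -/
def pairing (S : SymMat) (u w : Fin 4 → ℤ) : ℝ := ∑ i, ∑ j, (u i : ℝ) * S.1 i j * (w j : ℝ)

/-- `U ∈ GL(4, ℤ)` is an output of the Minkowski-Siegel reduction algorithm applied to `S`.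
Its first row minimizes `u S ᵗu` over nonzero integer vectors; each later row minimizes it over
the vectors that, placed below the previous rows, can be completed to a matrix in `GL(4, ℤ)`;
and consecutive rows have nonnegative pairing. -/
structure IsReductionOutput (S : SymMat) (U : GL (Fin 4) ℤ) : Prop where
  first_row : ∀ u : Fin 4 → ℤ, u ≠ 0 → pairing S (U.1 0) (U.1 0) ≤ pairing S u u
  next_row : ∀ k : Fin 4, k ≠ 0 → ∀ W : GL (Fin 4) ℤ, (∀ i : Fin 4, i < k → W.1 i = U.1 i) →
    pairing S (U.1 k) (U.1 k) ≤ pairing S (W.1 k) (W.1 k)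
  sign : ∀ k : Fin 3, 0 ≤ pairing S (U.1 k.castSucc) (U.1 k.succ)

/-- The set `𝓡` of reduced Gram matrices `R = U S ᵗU`, with `S` a Gram matrix and `U` produced
from `S` by the reduction algorithm. -/
def reducedGram : Set SymMat :=
  {R | ∃ S ∈ gramMatrices, ∃ U : GL (Fin 4) ℤ, IsReductionOutput S U ∧
    R.1 = U.1.map (Int.cast : ℤ → ℝ) * S.1 * (U.1.map (Int.cast : ℤ → ℝ)).transpose}

/-- Reduced bases of the lattice `L`. -/
def IsReducedBasis (L : AddSubgroup ℍ) (v : Fin 4 → ℍ) : Prop :=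
  IsBasisOf L v ∧ gramMat v ∈ reducedGram

/-- Special bases of `L`: reduced bases whose first vector is `1`. -/
def IsSpecialBasis (L : AddSubgroup ℍ) (v : Fin 4 → ℍ) : Prop :=
  IsReducedBasis L v ∧ v 0 = 1

/-- Tame bases of `L`: reduced bases whose Gram matrix is interior to `𝓡` in the
10-dimensional space of symmetric matrices. -/
def IsTameBasis (L : AddSubgroup ℍ) (v : Fin 4 → ℍ) : Prop :=
  IsReducedBasis L v ∧ gramMat v ∈ interior reducedGram

/-- A tame lattice is a rank-4 lattice with a tame basis. -/
def IsTameLattice (L : AddSubgroup ℍ) : Prop := ∃ v : Fin 4 → ℍ, IsTameBasis L v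

/-- The torus `ℍ / L` is tame: it is equivalent to `ℍ / L'` for some tame lattice `L'`. -/
def IsTameTorus (L : AddSubgroup ℍ) : Prop := ∃ L', IsTameLattice L' ∧ EquivalentTori L L'

/-! ### Moduli -/

/-- The quadruple `(1, v₂, v₃, v₄)`. -/
def withOne (p : ℍ × ℍ × ℍ) : Fin 4 → ℍ := ![1, p.1, p.2.1, p.2.2]

/-- The lattice `ℤ + ℤ v₂ + ℤ v₃ + ℤ v₄`. -/
def modLattice (p : ℍ × ℍ × ℍ) : AddSubgroup ℍ := latticeOf (withOne p)

/-- The fundamental set `𝓜`: the triples such that `{1, v₂, v₃, v₄}` is a special basis. -/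
def fundSet : Set (ℍ × ℍ × ℍ) := {p | IsSpecialBasis (modLattice p) (withOne p)}

/-- The set `𝓣` of points of `𝓜` such that `{1, v₂, v₃, v₄}` is a tame basis. -/
def tameSet : Set (ℍ × ℍ × ℍ) := {p | p ∈ fundSet ∧ IsTameBasis (modLattice p) (withOne p)}

/-- The point `p` of `𝓜` represents the modulus of the torus `ℍ / L`. -/
def IsModulus (p : ℍ × ℍ × ℍ) (L : AddSubgroup ℍ) : Prop :=
  p ∈ fundSet ∧ EquivalentTori L (modLattice p)

end

end QTorus

/-!
Two facts give the theorem.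

*Equivalent tori have lattices that differ by a right multiplication.* A regular map
`ℍ / L₁ → ℍ / L₂` lifts to a continuous `F : ℍ → ℍ`, because `ℍ → ℍ / L₂` is a covering. Each
`F (q + l) - F q` with `l ∈ L₁` is continuous in `q` and takes values in a discrete group, so it is
constant; subtracting from `F` a suitable real linear map leaves a periodic, hence bounded,
function, and `F` has linear growth (`exists_norm_le_of_lift`). On a slice `ℝ + I ℝ` the function
`F` is holomorphic for the complex structure given by left multiplication by `I`, so by Cauchy's
estimate and Liouville's theorem it is affine there (`eq_affine_on_slice`). The coefficients
`F 1 - F 0` and `F 0` do not depend on `I`, and `F q = q a + b` on all of `ℍ`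
(`IsRegularMap.lift_eq_affine`). If the map is bijective, then `a ≠ 0` and `L₂ = L₁ a`
(`EquivalentTori.rightSimilar`); the converse is a computation in charts.

*A tame basis is unique up to a global sign.* The inequalities defining reduced Gram matrices are
linear in the matrix, so those that are not identities become strict in the interior. If `S` is
interior and `U` reduces `S`, comparing the minimality of the rows of `U` with that of the unit
vectors shows, row by row, that the `k`-th row of `U` is plus or minus the `k`-th unit vector, and
the strict sign conditions then force all these signs to agree
(`IsReductionOutput.exists_eq_smul`).

Right multiplication by `a` is a similarity of ratio `‖a‖`, and the reduced Gram matrices form a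
cone, so tame bases go to tame bases. Multiplying a tame basis by the inverse of its first vector
gives a modulus in `𝓣`. If two points of `𝓣` define equivalent tori, the corresponding bases agree
up to a right multiplication and a sign, and comparing the first vectors, both `1`, shows
that the points are equal.
-/

namespace QTorus

open Filter Topology

/-! ### Rank-four lattices -/

theorem continuous_proj (L : AddSubgroup ℍ) : Continuous (proj L) := continuous_quot_mk

theorem isOpenMap_proj (L : AddSubgroup ℍ) : IsOpenMap (proj L) :=
  QuotientAddGroup.isOpenMap_coe

theorem proj_eq_proj {L : AddSubgroup ℍ} {p q : ℍ} : proj L p = proj L q ↔ -p + q ∈ L :=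
  QuotientAddGroup.eq

theorem proj_add_mem {L : AddSubgroup ℍ} (q : ℍ) {l : ℍ} (hl : l ∈ L) :
    proj L (q + l) = proj L q := by
  rw [proj_eq_proj]
  simpa using L.neg_mem hl

theorem latticeOf_eq_span (v : Fin 4 → ℍ) :
    latticeOf v = (Submodule.span ℤ (Set.range v)).toAddSubgroup :=
  (Submodule.span_int_eq_addSubgroupClosure _).symm

theorem mem_latticeOf {v : Fin 4 → ℍ} {q : ℍ} :
    q ∈ latticeOf v ↔ ∃ c : Fin 4 → ℤ, ∑ i, c i • v i = q := by
  rw [latticeOf_eq_span, Submodule.mem_toAddSubgroup, Submodule.mem_span_range_iff_exists_fun]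

theorem IsRankFourLattice.exists_basis {L : AddSubgroup ℍ} (hL : IsRankFourLattice L) :
    ∃ b : Module.Basis (Fin 4) ℝ ℍ, (Submodule.span ℤ (Set.range b)).toAddSubgroup = L := by
  obtain ⟨v, hv, rfl⟩ := hL
  refine ⟨basisOfLinearIndependentOfCardEqFinrank hv (by simp [Quaternion.finrank_eq_four]), ?_⟩
  rw [coe_basisOfLinearIndependentOfCardEqFinrank, latticeOf_eq_span]

theorem IsRankFourLattice.discreteTopology {L : AddSubgroup ℍ} (hL : IsRankFourLattice L) :
    DiscreteTopology L := by
  obtain ⟨b, rfl⟩ := hL.exists_basis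
  infer_instance

theorem IsRankFourLattice.isCoveringMap_proj {L : AddSubgroup ℍ} (hL : IsRankFourLattice L) :
    IsCoveringMap (proj L) :=
  have := hL.discreteTopology
  (L.isAddQuotientCoveringMap_of_comm ⟨inferInstance⟩).isCoveringMap

theorem eq_of_continuous_of_mem {L : AddSubgroup ℍ} (hL : IsRankFourLattice L) {g : ℍ → ℍ}
    (hg : Continuous g) (hmem : ∀ q, g q ∈ L) (p q : ℍ) : g p = g q := by
  have := hL.discreteTopology
  exact congrArg Subtype.val (PreconnectedSpace.constant (α := ℍ) inferInstance
    (hg.subtype_mk hmem) (x := p) (y := q))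

theorem exists_isChartDomain {L : AddSubgroup ℍ} (hL : IsRankFourLattice L) (q : ℍ) :
    ∃ U, IsChartDomain L U ∧ q ∈ U := by
  obtain ⟨e, he, h⟩ := hL.isCoveringMap_proj.isLocalHomeomorph q
  exact ⟨e.source, ⟨e.open_source, h ▸ e.injOn⟩, he⟩

theorem chart_proj {L : AddSubgroup ℍ} {V : Set ℍ} (hV : IsChartDomain L V) {q : ℍ} (hq : q ∈ V) :
    chart L V (proj L q) = q :=
  hV.2.leftInvOn_invFunOn hq

theorem isOpen_coordDomain {L₁ L₂ : AddSubgroup ℍ} {f : Torus L₁ → Torus L₂} (hf : Continuous f)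
    {U V : Set ℍ} (hU : IsOpen U) (hV : IsOpen V) : IsOpen (coordDomain f U V) :=
  hU.inter ((isOpenMap_proj L₂ V hV).preimage (hf.comp (continuous_proj L₁)))

/-- If `F` lifts `f`, a coordinate expression of `f` differs from `F`, near each point,
by an element of the target lattice. -/
theorem coordExpr_eventuallyEq {L₁ L₂ : AddSubgroup ℍ} {f : Torus L₁ → Torus L₂} {F : ℍ → ℍ}
    (hF : Continuous F) (hlift : ∀ q, f (proj L₁ q) = proj L₂ (F q)) {U V : Set ℍ}
    (hV : IsChartDomain L₂ V) {q : ℍ} (hq : q ∈ coordDomain f U V) :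
    ∃ l ∈ L₂, coordExpr f V =ᶠ[𝓝 q] fun x => F x + l := by
  obtain ⟨-, w, hw, hwq⟩ := hq
  rw [hlift] at hwq
  have hl : -F q + w ∈ L₂ := proj_eq_proj.1 hwq.symm
  refine ⟨-F q + w, hl, ?_⟩
  have hmem : ∀ᶠ x in 𝓝 q, F x + (-F q + w) ∈ V := by
    refine (hF.add continuous_const).continuousAt.eventually_mem (hV.1.mem_nhds ?_)
    simpa using hw
  filter_upwards [hmem] with x hx
  have : f (proj L₁ x) = proj L₂ (F x + (-F q + w)) := by rw [hlift, proj_add_mem _ hl]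
  simp only [coordExpr, Function.comp_apply, this, chart_proj hV hx]

/-! ### Right multiplications induce biregular diffeomorphisms -/

theorem slice_eq_smul (I : ℍ) : slice I = fun z : ℝ × ℝ => z.1 • (1 : ℍ) + z.2 • I := by
  ext1 z
  rw [slice, Quaternion.mul_coe_eq_smul, ← Quaternion.coe_mul_eq_smul z.1, mul_one]

theorem contDiff_slice (I : ℍ) {n : WithTop ℕ∞} : ContDiff ℝ n (slice I) := by
  rw [slice_eq_smul]
  fun_prop

theorem hasFDerivAt_slice (I : ℍ) (z : ℝ × ℝ) :
    HasFDerivAt (slice I) ((ContinuousLinearMap.fst ℝ ℝ ℝ).smulRight (1 : ℍ) +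
      (ContinuousLinearMap.snd ℝ ℝ ℝ).smulRight I) z := by
  rw [slice_eq_smul]
  exact (hasFDerivAt_fst.smul_const _).add (hasFDerivAt_snd.smul_const _)

theorem isSmoothMap_and_isRegularMap_of_mul {L₁ L₂ : AddSubgroup ℍ} {f : Torus L₁ → Torus L₂}
    {a : ℍ} (hf : ∀ q, f (proj L₁ q) = proj L₂ (q * a)) : IsSmoothMap f ∧ IsRegularMap f := by
  have hcont : Continuous f := by
    refine (QuotientAddGroup.isQuotientMap_mk (N := L₁)).continuous_iff.2 ?_
    exact ((continuous_proj L₂).comp (continuous_mul_const a)).congr fun q => (hf q).symm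
  refine ⟨⟨hcont, fun U V hU hV q hq => ?_⟩, hcont, fun U V hU hV I hI => ⟨fun z hz => ?_,
    fun z hz => ?_⟩⟩
  · obtain ⟨l, -, hl⟩ := coordExpr_eventuallyEq (continuous_mul_const a) hf hV hq
    exact (ContDiffAt.congr_of_eventuallyEq (by fun_prop) hl).contDiffWithinAt
  · obtain ⟨l, -, hl⟩ := coordExpr_eventuallyEq (continuous_mul_const a) hf hV hz
    exact (ContDiffAt.comp z (ContDiffAt.congr_of_eventuallyEq (by fun_prop) hl)
      (contDiff_slice I).contDiffAt).contDiffWithinAt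
  · obtain ⟨l, -, hl⟩ := coordExpr_eventuallyEq (continuous_mul_const a) hf hV hz
    have hd := ((hasFDerivAt_slice I z).mul_const' a).add_const l
    have : coordExpr f V ∘ slice I =ᶠ[𝓝 z] fun x => slice I x * a + l :=
      (contDiff_slice I (n := 0)).continuous.continuousAt.eventually hl
    rw [(hd.congr_of_eventuallyEq this).fderiv]
    simp [← mul_assoc, hI]

/-- Some right multiplication `q ↦ q a` with `a ≠ 0` carries `L₁` onto `L₂`. -/
def RightSimilar (L₁ L₂ : AddSubgroup ℍ) : Prop := ∃ a : ℍ, a ≠ 0 ∧ ∀ q, q * a ∈ L₂ ↔ q ∈ L₁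

theorem RightSimilar.symm {L₁ L₂ : AddSubgroup ℍ} (h : RightSimilar L₁ L₂) :
    RightSimilar L₂ L₁ := by
  obtain ⟨a, ha, h⟩ := h
  exact ⟨a⁻¹, inv_ne_zero ha, fun q => by rw [← h, inv_mul_cancel_right₀ ha]⟩

theorem RightSimilar.trans {L₁ L₂ L₃ : AddSubgroup ℍ} (h : RightSimilar L₁ L₂)
    (h' : RightSimilar L₂ L₃) : RightSimilar L₁ L₃ := by
  obtain ⟨a, ha, h⟩ := h
  obtain ⟨b, hb, h'⟩ := h'
  exact ⟨a * b, mul_ne_zero ha hb, fun q => by rw [← mul_assoc, h', h]⟩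

theorem RightSimilar.equivalentTori {L₁ L₂ : AddSubgroup ℍ} (h : RightSimilar L₁ L₂) :
    EquivalentTori L₁ L₂ := by
  obtain ⟨a, ha, h⟩ := h
  let e : ℍ ≃+ ℍ :=
    { toFun := (· * a)
      invFun := (· * a⁻¹)
      left_inv := mul_inv_cancel_right₀ ha
      right_inv := inv_mul_cancel_right₀ ha
      map_add' := fun x y => add_mul x y a }
  have hmap : L₁.map (e : ℍ →+ ℍ) = L₂ := by
    ext q
    constructor
    · rintro ⟨p, hp, rfl⟩
      exact (h p).2 hp
    · intro hq
      exact ⟨q * a⁻¹, (h _).1 (by rwa [inv_mul_cancel_right₀ ha]), inv_mul_cancel_right₀ ha q⟩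
  let f : Torus L₁ ≃+ Torus L₂ := QuotientAddGroup.congr L₁ L₂ e hmap
  have hf : ∀ q, f (proj L₁ q) = proj L₂ (q * a) := fun _ => rfl
  have hg : ∀ q, f.symm (proj L₂ q) = proj L₁ (q * a⁻¹) := fun q => by
    rw [AddEquiv.symm_apply_eq, hf, inv_mul_cancel_right₀ ha]
  obtain ⟨h₁, h₂⟩ := isSmoothMap_and_isRegularMap_of_mul hf
  obtain ⟨h₃, h₄⟩ := isSmoothMap_and_isRegularMap_of_mul hg
  exact ⟨f.toEquiv, ⟨h₁, h₃⟩, h₂, h₄⟩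

/-! ### Lifts of regular maps are affine -/

/-- A continuous lift `F` of a map of tori grows at most linearly: after subtracting a suitable
real linear map it becomes periodic. -/
theorem exists_norm_le_of_lift {L₁ L₂ : AddSubgroup ℍ} (h₁ : IsRankFourLattice L₁)
    (h₂ : IsRankFourLattice L₂) {f : Torus L₁ → Torus L₂} {F : ℍ → ℍ} (hF : Continuous F)
    (hlift : ∀ q, f (proj L₁ q) = proj L₂ (F q)) : ∃ C, ∀ q, ‖F q‖ ≤ C * (1 + ‖q‖) := by
  obtain ⟨b, rfl⟩ := h₁.exists_basis
  let A : ℍ →L[ℝ] ℍ := LinearMap.toContinuousLinearMap (b.constr ℝ fun i => F (b i) - F 0)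
  have hA : ∀ i, A (b i) = F (b i) - F 0 := fun i => b.constr_basis ℝ _ i
  have hstep : ∀ i q, F (q + b i) - F q = A (b i) := fun i q => by
    rw [hA]
    have := eq_of_continuous_of_mem h₂ (g := fun q => -F q + F (q + b i)) (by fun_prop)
      (fun q => proj_eq_proj.1 (by
        rw [← hlift, ← hlift, proj_add_mem _ (Submodule.subset_span (Set.mem_range_self i))])) q 0
    simpa [← sub_eq_neg_add] using this
  have hper : ∀ z w, w ∈ Submodule.span ℤ (Set.range b) → F (z + w) - A (z + w) = F z - A z := by
    intro z w hw
    induction hw using Submodule.span_induction generalizing z with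
    | mem x hx =>
      obtain ⟨i, rfl⟩ := hx
      rw [map_add, ← hstep i z]
      abel
    | zero => simp
    | add x y _ _ hx hy => rw [← add_assoc, hy, hx]
    | smul n x _ hx =>
      induction n using Int.induction_on generalizing z with
      | zero => simp
      | succ n ih => rw [add_smul, one_smul, ← add_assoc, hx, ih]
      | pred n ih => rw [sub_smul, one_smul, ← hx, ← ih z]; congr 2 <;> abel_nf
  obtain ⟨K, hK⟩ := (IsZLattice.isCompact_range_of_periodic _ (fun q => F q - A q)
    (by fun_prop) hper).isBounded.exists_norm_le
  have hK' : ∀ q, ‖F q - A q‖ ≤ K := fun q => hK _ ⟨q, rfl⟩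
  have hK0 : 0 ≤ K := (norm_nonneg _).trans (hK' 0)
  refine ⟨K + ‖A‖, fun q => ?_⟩
  have h1 := norm_add_le (F q - A q) (A q)
  rw [sub_add_cancel] at h1
  nlinarith [hK' q, A.le_opNorm q, norm_nonneg q, norm_nonneg A, mul_nonneg hK0 (norm_nonneg q)]

/-- An entire function of linear growth is affine. -/
theorem eq_affine_of_norm_le {g : ℂ → ℂ} (hg : Differentiable ℂ g) {C : ℝ}
    (hC : ∀ z, ‖g z‖ ≤ C * (1 + ‖z‖)) (z : ℂ) : g z = g 0 + z * (g 1 - g 0) := by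
  have hC0 : 0 ≤ C := by simpa using (norm_nonneg _).trans (hC 0)
  -- Cauchy's estimate on the circle of radius `1 + ‖c‖` about `c`
  have hb : ∀ c, ‖deriv g c‖ ≤ 2 * C := fun c => by
    have hR : 0 < 1 + ‖c‖ := by positivity
    refine (Complex.norm_deriv_le_of_forall_mem_sphere_norm_le hR hg.diffContOnCl
      (C := C * (2 * (1 + ‖c‖))) fun z hz => (hC z).trans ?_).trans_eq (by field_simp)
    have h1 : ‖z‖ ≤ ‖z - c‖ + ‖c‖ := by simpa using norm_add_le (z - c) c
    rw [mem_sphere_iff_norm] at hz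
    gcongr
    linarith
  have hd : ∀ c, deriv g c = deriv g 0 := fun c =>
    hg.deriv.apply_eq_apply_of_bounded (isBounded_iff_forall_norm_le.2
      ⟨2 * C, by rintro _ ⟨c, rfl⟩; exact hb c⟩) c 0
  have hlin : ∀ z, g z = g 0 + z * deriv g 0 := fun z => by
    have hh : Differentiable ℂ fun z => g z - z * deriv g 0 := by fun_prop
    have := is_const_of_deriv_eq_zero hh (fun c => by
      rw [deriv_fun_sub (hg c) (by fun_prop), hd c]
      simp) z 0
    simp only [zero_mul, sub_zero] at this
    linear_combination this
  have h1 := hlin 1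
  rw [hlin z]
  linear_combination (-z) * h1

/-- For an imaginary unit `I`, the form `w ↦ ⟪w, p⟫ - i ⟪I w, p⟫`, which is `ℂ`-linear when `i`
acts on `ℍ` as left multiplication by `I`. -/
noncomputable def sliceForm (I p : ℍ) : ℍ →L[ℝ] ℂ :=
  LinearMap.toContinuousLinearMap
    { toFun := fun w => (inner ℝ p w : ℝ) - Complex.I * (inner ℝ p (I * w) : ℝ)
      map_add' := fun x y => by
        simp only [mul_add, inner_add_right, Complex.ofReal_add]
        ring
      map_smul' := fun r x => by
        simp only [mul_smul_comm, inner_smul_right, Complex.ofReal_mul, RingHom.id_apply,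
          Complex.real_smul]
        ring }

theorem sliceForm_apply (I p w : ℍ) :
    sliceForm I p w = (inner ℝ p w : ℝ) - Complex.I * (inner ℝ p (I * w) : ℝ) := rfl

theorem re_sliceForm (I p w : ℍ) : (sliceForm I p w).re = inner ℝ p w := by
  simp [sliceForm_apply]

theorem sliceForm_mul {I : ℍ} (hI : I * I = -1) (p w : ℍ) :
    sliceForm I p (I * w) = Complex.I * sliceForm I p w := by
  rw [sliceForm_apply, sliceForm_apply, ← mul_assoc, hI, neg_one_mul, inner_neg_right, mul_sub,
    ← mul_assoc, Complex.I_mul_I]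
  push_cast
  ring

/-- A slice regular function on `ℍ` of linear growth is of the form `q ↦ q a + b` on each slice. -/
theorem eq_affine_on_slice {F : ℍ → ℍ} {I : ℍ} (hI : I * I = -1)
    (hd : ∀ z, DifferentiableAt ℝ (F ∘ slice I) z)
    (hcr : ∀ z, fderiv ℝ (F ∘ slice I) z (1, 0) + I * fderiv ℝ (F ∘ slice I) z (0, 1) = 0)
    {C : ℝ} (hC : ∀ q, ‖F q‖ ≤ C * (1 + ‖q‖)) (z : ℝ × ℝ) :
    F (slice I z) = slice I z * (F 1 - F 0) + F 0 := by
  have hC0 : 0 ≤ C := by simpa using (norm_nonneg _).trans (hC 0)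
  have hnI : ‖I‖ = 1 := by
    have : ‖I‖ * ‖I‖ = 1 := by rw [← norm_mul, hI, norm_neg, norm_one]
    nlinarith [norm_nonneg I]
  have hs0 : slice I (0, 0) = 0 := by simp [slice]
  have hs1 : slice I (1, 0) = 1 := by simp [slice]
  refine ext_inner_left ℝ fun p => ?_
  let g : ℂ → ℂ := fun ζ => sliceForm I p (F (slice I (Complex.equivRealProdCLM ζ)))
  have hderiv : ∀ ζ, HasFDerivAt g ((sliceForm I p).comp ((fderiv ℝ (F ∘ slice I)
      (Complex.equivRealProdCLM ζ)).comp (Complex.equivRealProdCLM : ℂ →L[ℝ] ℝ × ℝ))) ζ :=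
    fun ζ => (sliceForm I p).hasFDerivAt.comp ζ
      ((hd _).hasFDerivAt.comp ζ Complex.equivRealProdCLM.hasFDerivAt)
  have hg : Differentiable ℂ g := fun ζ => by
    rw [differentiableAt_complex_iff_differentiableAt_real]
    refine ⟨(hderiv ζ).differentiableAt, ?_⟩
    rw [(hderiv ζ).fderiv]
    have h := congrArg (I * ·) (hcr (Complex.equivRealProdCLM ζ))
    simp only [mul_add, ← mul_assoc, hI, neg_one_mul, mul_zero, ← sub_eq_add_neg,
      sub_eq_zero] at h
    have e1 : Complex.equivRealProdCLM 1 = (1, 0) := rfl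
    have e2 : Complex.equivRealProdCLM Complex.I = (0, 1) := rfl
    simp only [ContinuousLinearMap.comp_apply, ContinuousLinearEquiv.coe_coe, e1, e2, ← h,
      sliceForm_mul hI, smul_eq_mul]
  have hnorm : ∀ ζ, ‖slice I (Complex.equivRealProdCLM ζ)‖ ≤ 2 * ‖ζ‖ := fun ζ => by
    have : ‖slice I (Complex.equivRealProdCLM ζ)‖ ≤ ‖ζ.re‖ + ‖ζ.im‖ := by
      refine (norm_add_le _ _).trans ?_
      rw [norm_mul, hnI, one_mul, Quaternion.norm_coe, Quaternion.norm_coe]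
      rfl
    have h1 := Complex.abs_re_le_norm ζ
    have h2 := Complex.abs_im_le_norm ζ
    simp only [Real.norm_eq_abs] at this
    linarith
  have hgC : ∀ ζ, ‖g ζ‖ ≤ (‖sliceForm I p‖ * (2 * C)) * (1 + ‖ζ‖) := fun ζ => by
    refine ((sliceForm I p).le_opNorm _).trans ?_
    rw [mul_assoc]
    gcongr
    refine (hC _).trans ?_
    have := mul_le_mul_of_nonneg_left (hnorm ζ) hC0
    linarith
  have key := congrArg Complex.re (eq_affine_of_norm_le hg hgC (Complex.equivRealProdCLM.symm z))
  have e0 : g 0 = sliceForm I p (F 0) := by rw [← hs0]; rfl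
  have e1 : g 1 = sliceForm I p (F 1) := by rw [← hs1]; rfl
  have ez : g (Complex.equivRealProdCLM.symm z) = sliceForm I p (F (slice I z)) := by
    simp only [g, ContinuousLinearEquiv.apply_symm_apply]
  have emul : Complex.equivRealProdCLM.symm z * (g 1 - g 0) =
      sliceForm I p (slice I z * (F 1 - F 0)) := by
    have hz : slice I z * (F 1 - F 0) = z.1 • (F 1 - F 0) + z.2 • (I * (F 1 - F 0)) := by
      simp [slice, add_mul, mul_assoc, Quaternion.coe_mul_eq_smul]
    have hz' : Complex.equivRealProdCLM.symm z = z.1 + z.2 * Complex.I := by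
      apply Complex.ext <;> simp
    rw [hz, map_add, map_smul, map_smul, sliceForm_mul hI, map_sub, hz', e0, e1]
    simp only [Complex.real_smul]
    ring
  rw [emul, e0, ez, Complex.add_re, re_sliceForm, re_sliceForm, re_sliceForm] at key
  rw [key, inner_add_right, add_comm]

theorem exists_mem_slice (q : ℍ) : ∃ I : ℍ, I * I = -1 ∧ ∃ z, slice I z = q := by
  by_cases h : q.im = 0
  · refine ⟨(Complex.I : ℂ), ?_, (q.re, 0), ?_⟩
    · rw [← Quaternion.coeComplex_mul, Complex.I_mul_I]
      ext <;> simp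
    · simp only [slice, Quaternion.coe_zero, mul_zero]
      conv_rhs => rw [← q.re_add_im, h]
  · have hn : ‖q.im‖ ≠ 0 := norm_ne_zero_iff.2 h
    have hsq : q.im * q.im = -((‖q.im‖ * ‖q.im‖ : ℝ) : ℍ) := by
      have := Quaternion.self_mul_star q.im
      rw [Quaternion.star_im, mul_neg, Quaternion.normSq_eq_norm_mul_self] at this
      rw [← this, neg_neg]
    refine ⟨‖q.im‖⁻¹ • q.im, ?_, (q.re, ‖q.im‖), ?_⟩
    · rw [smul_mul_smul_comm, hsq, smul_neg, ← Quaternion.coe_smul, smul_eq_mul]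
      field_simp
      simp
    · simp only [slice]
      rw [Quaternion.mul_coe_eq_smul, smul_smul, mul_inv_cancel₀ hn, one_smul, q.re_add_im]

/-- A continuous lift to `ℍ` of a regular map of tori has the form `q ↦ q a + b`. -/
theorem IsRegularMap.lift_eq_affine {L₁ L₂ : AddSubgroup ℍ} (h₁ : IsRankFourLattice L₁)
    (h₂ : IsRankFourLattice L₂) {f : Torus L₁ → Torus L₂} (hf : IsRegularMap f) {F : ℍ → ℍ}
    (hF : Continuous F) (hlift : ∀ q, f (proj L₁ q) = proj L₂ (F q)) (q : ℍ) :
    F q = q * (F 1 - F 0) + F 0 := by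
  obtain ⟨C, hC⟩ := exists_norm_le_of_lift h₁ h₂ hF hlift
  obtain ⟨I, hI, z, rfl⟩ := exists_mem_slice q
  -- near each point, `F` is a translate of a coordinate expression of `f`
  have hloc : ∀ z, ∃ G : ℝ × ℝ → ℍ, DifferentiableAt ℝ G z ∧
      fderiv ℝ G z (1, 0) + I * fderiv ℝ G z (0, 1) = 0 ∧ ∃ l, F ∘ slice I =ᶠ[𝓝 z] (G · - l) := by
    intro z
    obtain ⟨U, hU, hzU⟩ := exists_isChartDomain h₁ (slice I z)
    obtain ⟨V, hV, hzV⟩ := exists_isChartDomain h₂ (F (slice I z))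
    have hmem : slice I z ∈ coordDomain f U V := ⟨hzU, _, hzV, (hlift _).symm⟩
    obtain ⟨hd, hcr⟩ := hf.2 U V hU hV I hI
    have hopen := (isOpen_coordDomain hf.1 hU.1 hV.1).preimage (contDiff_slice I (n := 0)).continuous
    obtain ⟨l, -, hl⟩ := coordExpr_eventuallyEq hF hlift hV hmem
    refine ⟨coordExpr f V ∘ slice I, (hd.differentiableOn one_ne_zero).differentiableAt
      (hopen.mem_nhds hmem), ?_, l, ?_⟩
    · exact (smul_eq_zero.1 (hcr z hmem)).resolve_left (by norm_num)
    · filter_upwards [(contDiff_slice I (n := 0)).continuous.continuousAt.eventually hl] with x hx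
      simp [hx]
  refine eq_affine_on_slice hI (fun z => ?_) (fun z => ?_) hC z
  · obtain ⟨G, hG, -, l, hl⟩ := hloc z
    exact (hG.sub_const l).congr_of_eventuallyEq hl
  · obtain ⟨G, hG, hcr, l, hl⟩ := hloc z
    rwa [hl.fderiv_eq, fderiv_sub_const]

theorem EquivalentTori.rightSimilar {L₁ L₂ : AddSubgroup ℍ} (h₁ : IsRankFourLattice L₁)
    (h₂ : IsRankFourLattice L₂) (h : EquivalentTori L₁ L₂) : RightSimilar L₁ L₂ := by
  obtain ⟨f, -, hf, -⟩ := h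
  obtain ⟨w, hw⟩ := Quotient.mk_surjective (f (proj L₁ 0))
  obtain ⟨F, ⟨-, hF⟩, -⟩ := h₂.isCoveringMap_proj.existsUnique_continuousMap_lifts
    ⟨f ∘ proj L₁, hf.1.comp (continuous_proj L₁)⟩ 0 w hw
  have hlift : ∀ q, f (proj L₁ q) = proj L₂ (F q) := fun q => (congrFun hF q).symm
  have haff := hf.lift_eq_affine h₁ h₂ F.continuous hlift
  have key : ∀ q, q * (F 1 - F 0) ∈ L₂ ↔ q ∈ L₁ := fun q => by
    have e : proj L₂ (F 0) = proj L₂ (F q) ↔ proj L₁ 0 = proj L₁ q := by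
      rw [← hlift, ← hlift, f.injective.eq_iff]
    rw [proj_eq_proj, proj_eq_proj, haff q] at e
    simpa using e
  refine ⟨F 1 - F 0, fun h0 => ?_, key⟩
  -- otherwise `L₁` is all of `ℍ`, which is not discrete
  have := eq_of_continuous_of_mem h₁ continuous_id (fun q => (key q).1 (by simp [h0])) 0 1
  simp at this

/-! ### Change of basis and the reduction algorithm -/

theorem pairing_eq_dotProduct (S : SymMat) (u w : Fin 4 → ℤ) :
    pairing S u w =
      Matrix.vecMul (Int.castRingHom ℝ ∘ u) S.1 ⬝ᵥ (Int.castRingHom ℝ ∘ w) := by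
  simp only [pairing, dotProduct, Matrix.vecMul, Finset.sum_mul, Function.comp_apply,
    eq_intCast]
  exact Finset.sum_comm

theorem pairing_single (S : SymMat) (i j : Fin 4) :
    pairing S (Pi.single i 1) (Pi.single j 1) = S.1 i j := by
  simp [pairing, Pi.single_apply]

theorem pairing_smul_smul (S : SymMat) (m n : ℤ) (u w : Fin 4 → ℤ) :
    pairing S (m • u) (n • w) = m * n * pairing S u w := by
  simp only [pairing, Finset.mul_sum, Pi.smul_apply, smul_eq_mul, Int.cast_mul]
  exact Finset.sum_congr rfl fun i _ => Finset.sum_congr rfl fun j _ => by ring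

theorem pairing_of_eq_conj {S R : SymMat} {T : Matrix (Fin 4) (Fin 4) ℤ}
    (h : R.1 = T.map (Int.cast : ℤ → ℝ) * S.1 * (T.map (Int.cast : ℤ → ℝ)).transpose)
    (u w : Fin 4 → ℤ) : pairing R u w = pairing S (Matrix.vecMul u T) (Matrix.vecMul w T) := by
  have hv : ∀ x : Fin 4 → ℤ, Int.castRingHom ℝ ∘ Matrix.vecMul x T =
      Matrix.vecMul (Int.castRingHom ℝ ∘ x) (T.map (Int.cast : ℤ → ℝ)) := fun x =>
    funext fun i => RingHom.map_vecMul (Int.castRingHom ℝ) T x i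
  rw [pairing_eq_dotProduct, pairing_eq_dotProduct, hv, hv, h, ← Matrix.vecMul_vecMul,
    ← Matrix.vecMul_vecMul, ← Matrix.dotProduct_mulVec, Matrix.mulVec_transpose]

theorem GL_row_mul (V U : GL (Fin 4) ℤ) (k : Fin 4) :
    (V * U).1 k = Matrix.vecMul (V.1 k) U.1 := by
  rw [Units.val_mul, Matrix.mul_apply_eq_vecMul]

theorem GL_row_one (k : Fin 4) : (1 : GL (Fin 4) ℤ).1 k = Pi.single k 1 := by
  ext j
  simp [Matrix.one_apply, Pi.single_apply, eq_comm]

theorem GL_row_ne_zero (U : GL (Fin 4) ℤ) (k : Fin 4) : U.1 k ≠ 0 := fun h => by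
  have h1 := GL_row_mul U U⁻¹ k
  rw [mul_inv_cancel, h, Matrix.zero_vecMul, GL_row_one] at h1
  simpa using congrFun h1 k

/-- `U` reduces `S` exactly when `U S ᵗU` is already reduced by the identity. -/
theorem isReductionOutput_iff_of_eq_conj {S R : SymMat} {U : GL (Fin 4) ℤ}
    (h : R.1 = U.1.map (Int.cast : ℤ → ℝ) * S.1 * (U.1.map (Int.cast : ℤ → ℝ)).transpose) :
    IsReductionOutput S U ↔ IsReductionOutput R 1 := by
  have hp := pairing_of_eq_conj h
  have hrow : ∀ V : GL (Fin 4) ℤ, ∀ i j,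
      pairing R (V.1 i) (V.1 j) = pairing S ((V * U).1 i) ((V * U).1 j) := fun V i j => by
    rw [hp, GL_row_mul, GL_row_mul]
  have hrow' : ∀ i j, pairing R ((1 : GL (Fin 4) ℤ).1 i) ((1 : GL (Fin 4) ℤ).1 j) =
      pairing S (U.1 i) (U.1 j) := fun i j => by rw [hrow, one_mul]
  constructor
  · rintro ⟨h1, h2, h3⟩
    refine ⟨fun u hu => ?_, fun k hk W hW => ?_, fun k => ?_⟩
    · rw [hrow', hp]
      refine h1 _ fun h0 => hu ?_
      have := congrArg (Matrix.vecMul · (U⁻¹).1) h0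
      simpa [Matrix.vecMul_vecMul, ← Units.val_mul] using this
    · rw [hrow', hrow]
      refine h2 k hk _ fun i hi => ?_
      rw [GL_row_mul, hW i hi, ← GL_row_mul, one_mul]
    · rw [hrow']
      exact h3 k
  · rintro ⟨h1, h2, h3⟩
    refine ⟨fun u hu => ?_, fun k hk W hW => ?_, fun k => ?_⟩
    · have e : Matrix.vecMul (Matrix.vecMul u (U⁻¹).1) U.1 = u := by
        rw [Matrix.vecMul_vecMul, ← Units.val_mul, inv_mul_cancel, Units.val_one,
          Matrix.vecMul_one]
      have := h1 (Matrix.vecMul u (U⁻¹).1) fun h0 => hu (by rw [← e, h0, Matrix.zero_vecMul])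
      rwa [hrow', hp, e] at this
    · have := h2 k hk (W * U⁻¹) fun i hi => by
        rw [GL_row_mul, hW i hi, ← GL_row_mul, mul_inv_cancel]
      rwa [hrow', hrow, inv_mul_cancel_right] at this
    · rw [← hrow']
      exact h3 k

theorem isReductionOutput_one_of_mem {R : SymMat} (hR : R ∈ reducedGram) :
    IsReductionOutput R 1 := by
  obtain ⟨S, -, U, hU, h⟩ := hR
  exact (isReductionOutput_iff_of_eq_conj h).1 hU

/-! ### Rigidity of reduced bases in the interior -/

/-- From an interior point of the reduced Gram matrices one may move a little in any
direction `-E`. -/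
theorem exists_sub_mem_of_mem_interior {S : SymMat} (hS : S ∈ interior reducedGram) (E : SymMat) :
    ∃ t : ℝ, 0 < t ∧ ∃ R ∈ reducedGram,
      ∀ u w, pairing R u w = pairing S u w - t * pairing E u w := by
  let γ : ℝ → SymMat := fun t => ⟨S.1 - t • E.1, S.2.sub (E.2.smul t)⟩
  have hγ : Continuous γ := by
    refine Continuous.subtype_mk ?_ _
    fun_prop
  have h0 : γ 0 = S := Subtype.ext (by simp [γ])
  have hev : ∀ᶠ t in 𝓝[>] (0 : ℝ), γ t ∈ reducedGram := by
    refine nhdsWithin_le_nhds (hγ.continuousAt.eventually_mem ?_)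
    rw [h0]
    exact mem_interior_iff_mem_nhds.1 hS
  obtain ⟨t, ht, ht0⟩ := (hev.and self_mem_nhdsWithin).exists
  refine ⟨t, ht0, γ t, ht, fun u w => ?_⟩
  rw [pairing_eq_dotProduct, pairing_eq_dotProduct, pairing_eq_dotProduct]
  simp only [γ, Matrix.vecMul_sub, Matrix.vecMul_smul, sub_dotProduct, smul_dotProduct,
    smul_eq_mul]

/-- A minimality inequality valid for all reduced Gram matrices is strict in the interior,
unless it is trivial. -/
theorem eq_single_of_mem_interior {S : SymMat} (hS : S ∈ interior reducedGram) {k : Fin 4}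
    {u : Fin 4 → ℤ} (hu : u ≠ 0)
    (hmin : ∀ R ∈ reducedGram,
      pairing R (Pi.single k 1) (Pi.single k 1) ≤ pairing R u u)
    (hle : pairing S u u ≤ pairing S (Pi.single k 1) (Pi.single k 1)) :
    ∃ ε : ℤˣ, u = (ε : ℤ) • Pi.single k 1 := by
  by_contra hne
  -- a coordinate in which `u` is larger than the `k`-th unit vector
  obtain ⟨j, hj⟩ : ∃ j, (Pi.single k 1 : Fin 4 → ℤ) j ^ 2 < u j ^ 2 := by
    by_contra! hall
    have h0 : ∀ j, j ≠ k → u j = 0 := fun j hj => by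
      have := hall j
      rw [Pi.single_eq_of_ne hj] at this
      nlinarith [sq_nonneg (u j)]
    have hk := hall k
    rw [Pi.single_eq_same, one_pow, sq_le_one_iff_abs_le_one] at hk
    have hk0 : u k ≠ 0 := fun h => hu (funext fun j => by
      by_cases hjk : j = k
      · rw [hjk, h]; rfl
      · exact h0 j hjk)
    have hunit : IsUnit (u k) := Int.isUnit_iff_abs_eq.2
      (le_antisymm hk (Int.one_le_abs hk0))
    refine hne ⟨hunit.unit, funext fun j => ?_⟩
    by_cases hjk : j = k
    · subst hjk; simp
    · simp [hjk, h0 j hjk]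
  obtain ⟨t, ht, R, hR, hpair⟩ := exists_sub_mem_of_mem_interior hS
    ⟨Matrix.single j j 1, by simp [Matrix.IsSymm]⟩
  have hE : ∀ v : Fin 4 → ℤ, pairing ⟨Matrix.single j j 1, by simp [Matrix.IsSymm]⟩ v v =
      ((v j ^ 2 : ℤ) : ℝ) := fun v => by
    simp [pairing, Matrix.single_apply, ite_and, sq]
  have h1 := hmin R hR
  rw [hpair, hpair, hE, hE] at h1
  have h2 : (((Pi.single k 1 : Fin 4 → ℤ) j ^ 2 : ℤ) : ℝ) < ((u j ^ 2 : ℤ) : ℝ) := by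
    exact_mod_cast hj
  nlinarith [mul_lt_mul_of_pos_left h2 ht]

theorem pos_of_mem_interior {S : SymMat} (hS : S ∈ interior reducedGram) (k : Fin 3) :
    0 < S.1 k.castSucc k.succ := by
  have hne : k.castSucc ≠ k.succ := (Fin.castSucc_lt_succ).ne
  obtain ⟨t, ht, R, hR, hpair⟩ := exists_sub_mem_of_mem_interior hS
    ⟨Matrix.single k.castSucc k.succ 1 + Matrix.single k.succ k.castSucc 1, by
      simp [Matrix.IsSymm, add_comm]⟩
  have h1 := (isReductionOutput_one_of_mem hR).sign k
  rw [GL_row_one, GL_row_one, hpair, pairing_single, pairing_single] at h1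
  simp [hne, hne.symm] at h1
  linarith

/-- The diagonal matrix of a family of signs, as an element of `GL(4, ℤ)`. -/
def signGL (ε : Fin 4 → ℤˣ) : GL (Fin 4) ℤ where
  val := Matrix.diagonal fun i => (ε i : ℤ)
  inv := Matrix.diagonal fun i => (ε i : ℤ)
  val_inv := by simp [Matrix.diagonal_mul_diagonal, ← Units.val_mul]
  inv_val := by simp [Matrix.diagonal_mul_diagonal, ← Units.val_mul]

theorem signGL_mul_row (ε : Fin 4 → ℤˣ) (U : GL (Fin 4) ℤ) (k : Fin 4) :
    (signGL ε * U).1 k = (ε k : ℤ) • U.1 k := by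
  ext j
  simp [signGL, Matrix.diagonal_mul]

theorem signGL_row (ε : Fin 4 → ℤˣ) (k : Fin 4) :
    (signGL ε).1 k = (ε k : ℤ) • Pi.single k 1 := by
  rw [← GL_row_one, ← signGL_mul_row, mul_one]

/-- A Gram matrix in the interior of the reduced ones is reduced only by `±1`. -/
theorem IsReductionOutput.exists_eq_smul {S : SymMat} (hS : S ∈ interior reducedGram)
    {U : GL (Fin 4) ℤ} (hU : IsReductionOutput S U) :
    ∃ ε : ℤˣ, ∀ k, U.1 k = (ε : ℤ) • Pi.single k 1 := by
  have hrow : ∀ k, ∃ ε : ℤˣ, U.1 k = (ε : ℤ) • Pi.single k 1 := by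
    intro k
    induction k using WellFoundedLT.induction with
    | ind k ih =>
    by_cases hk : k = 0
    · subst hk
      refine eq_single_of_mem_interior hS (GL_row_ne_zero U 0) (fun R hR => ?_)
        (hU.first_row _ (by simp))
      simpa only [GL_row_one] using
        (isReductionOutput_one_of_mem hR).first_row _ (GL_row_ne_zero U 0)
    · choose! ε hε using ih
      -- `D` completes the first `k` rows of `U` by the unit vectors
      let D := signGL fun i => if i < k then ε i else 1
      have hD : ∀ i, i < k → D.1 i = U.1 i := fun i hi => by
        rw [signGL_row, if_pos hi, hε i hi]
      have hDk : D.1 k = Pi.single k 1 := by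
        rw [signGL_row, if_neg (lt_irrefl k), Units.val_one, one_smul]
      refine eq_single_of_mem_interior hS (GL_row_ne_zero U k) (fun R hR => ?_)
        (hDk ▸ hU.next_row k hk D hD)
      -- flipping the signs of the rows of `U` before `k` turns them into unit vectors, so `U k`
      -- competes with the `k`-th unit vector in every reduced Gram matrix
      have := (isReductionOutput_one_of_mem hR).next_row k hk (D * U) fun i hi => by
        rw [signGL_mul_row, if_pos hi, hε i hi, smul_smul, ← Units.val_mul, Int.units_mul_self,
          Units.val_one, one_smul, GL_row_one]
      rwa [GL_row_one, signGL_mul_row, if_neg (lt_irrefl k), Units.val_one, one_smul] at this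
  choose ε hε using hrow
  have hsucc : ∀ k : Fin 3, ε k.castSucc = ε k.succ := fun k => by
    have h1 := hU.sign k
    rw [hε, hε, pairing_smul_smul, pairing_single] at h1
    have h2 := pos_of_mem_interior hS k
    rcases Int.units_eq_one_or (ε k.castSucc) with h | h <;>
      rcases Int.units_eq_one_or (ε k.succ) with h' | h' <;> rw [h, h'] at h1 ⊢ <;>
      norm_num at h1 <;> linarith
  refine ⟨ε 0, fun k => ?_⟩
  have h0 := hsucc 0
  have h1 := hsucc 1
  have h2 := hsucc 2
  have : ε k = ε 0 := by
    fin_cases k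
    · rfl
    · exact h0.symm
    · exact (h0.trans h1).symm
    · exact (h0.trans (h1.trans h2)).symm
  rw [hε, this]

theorem gramMat_eq_conj {w w' : Fin 4 → ℍ} {T : Matrix (Fin 4) (Fin 4) ℤ}
    (hT : ∀ i, ∑ j, T i j • w j = w' i) :
    (gramMat w').1 = T.map (Int.cast : ℤ → ℝ) * (gramMat w).1 *
      (T.map (Int.cast : ℤ → ℝ)).transpose := by
  ext i j
  simp only [gramMat, Matrix.of_apply, Matrix.mul_apply, Matrix.transpose_apply, Matrix.map_apply,
    ← hT, sum_inner, inner_sum, ← Int.cast_smul_eq_zsmul ℝ, inner_smul_left, inner_smul_right,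
    Finset.sum_mul]
  refine Finset.sum_congr rfl fun k _ => ?_
  rw [Finset.mul_sum]
  refine Finset.sum_congr rfl fun l _ => ?_
  rw [conj_trivial]
  ring

/-- A basis of a lattice is carried to any other one by a matrix in `GL(4, ℤ)`. -/
theorem exists_GL_of_isBasisOf {L : AddSubgroup ℍ} {w w' : Fin 4 → ℍ} (hw : IsBasisOf L w)
    (hw' : IsBasisOf L w') : ∃ U : GL (Fin 4) ℤ, ∀ i, ∑ j, U.1 i j • w j = w' i := by
  have hex : ∀ {x y : Fin 4 → ℍ}, IsBasisOf L x → IsBasisOf L y →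
      ∃ T : Matrix (Fin 4) (Fin 4) ℤ, ∀ i, ∑ j, T i j • x j = y i := fun {x y} hx hy => by
    have : ∀ i, ∃ c : Fin 4 → ℤ, ∑ j, c j • x j = y i := fun i => mem_latticeOf.1
      (hx.2.trans hy.2.symm ▸ AddSubgroup.subset_closure (Set.mem_range_self i))
    choose T hT using this
    exact ⟨T, hT⟩
  have hinv : ∀ {x y : Fin 4 → ℍ} {T T' : Matrix (Fin 4) (Fin 4) ℤ}, IsBasisOf L x →
      (∀ i, ∑ j, T i j • x j = y i) → (∀ i, ∑ j, T' i j • y j = x i) → T' * T = 1 := by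
    intro x y T T' hx hT hT'
    have hli : LinearIndependent ℤ x := hx.1.restrict_scalars
      (by intro a b h; simpa using h)
    ext i k
    have h0 : ∑ j, ((T' * T) i j - (1 : Matrix (Fin 4) (Fin 4) ℤ) i j) • x j = 0 := by
      simp only [sub_smul, Finset.sum_sub_distrib, Matrix.mul_apply, Finset.sum_smul, mul_smul]
      rw [Finset.sum_comm]
      simp only [← Finset.smul_sum, hT, hT', Matrix.one_apply, ite_smul, one_smul, zero_smul,
        Finset.sum_ite_eq, Finset.mem_univ, if_true, sub_self]
    exact sub_eq_zero.1 (Fintype.linearIndependent_iff.1 hli _ h0 k)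
  obtain ⟨T, hT⟩ := hex hw hw'
  obtain ⟨T', hT'⟩ := hex hw' hw
  exact ⟨⟨T, T', hinv hw' hT' hT, hinv hw hT hT'⟩, hT⟩

/-- A tame basis is, up to a global sign, the only reduced basis of its lattice. -/
theorem IsTameBasis.exists_eq_smul {L : AddSubgroup ℍ} {w w' : Fin 4 → ℍ} (hw : IsTameBasis L w)
    (hw' : IsReducedBasis L w') : ∃ ε : ℤˣ, ∀ i, w' i = (ε : ℤ) • w i := by
  obtain ⟨U, hU⟩ := exists_GL_of_isBasisOf hw.1.1 hw'.1
  have hout := (isReductionOutput_iff_of_eq_conj (gramMat_eq_conj hU)).2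
    (isReductionOutput_one_of_mem hw'.2)
  obtain ⟨ε, hε⟩ := hout.exists_eq_smul hw.2
  refine ⟨ε, fun i => ?_⟩
  rw [← hU i, hε i]
  simp [Pi.single_apply]

/-! ### Scaling -/

/-- Multiplication of a symmetric matrix by the scalar `c`. -/
def scaleSym (c : ℝ) (S : SymMat) : SymMat := ⟨c • S.1, S.2.smul c⟩

theorem continuous_scaleSym (c : ℝ) : Continuous (scaleSym c) :=
  (continuous_subtype_val.const_smul c).subtype_mk _

theorem scaleSym_scaleSym_inv {c : ℝ} (hc : c ≠ 0) (S : SymMat) :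
    scaleSym c (scaleSym c⁻¹ S) = S :=
  Subtype.ext (smul_inv_smul₀ hc S.1)

theorem inner_mul_right_mul_right (a p q : ℍ) :
    inner ℝ (p * a) (q * a) = ‖a‖ ^ 2 * inner ℝ p q := by
  rw [Quaternion.inner_def, Quaternion.inner_def, star_mul, mul_assoc, ← mul_assoc a,
    Quaternion.self_mul_star, Quaternion.normSq_eq_norm_mul_self, Quaternion.coe_mul_eq_smul,
    mul_smul_comm, Quaternion.re_smul, smul_eq_mul, sq]

theorem gramMat_mul_right (v : Fin 4 → ℍ) (a : ℍ) :
    gramMat (fun i => v i * a) = scaleSym (‖a‖ ^ 2) (gramMat v) := by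
  refine Subtype.ext (Matrix.ext fun i j => ?_)
  simp [gramMat, scaleSym, inner_mul_right_mul_right]

theorem linearIndependent_mul_right {v : Fin 4 → ℍ} (hv : LinearIndependent ℝ v) {a : ℍ}
    (ha : a ≠ 0) : LinearIndependent ℝ fun i => v i * a :=
  hv.map' (LinearMap.mulRight ℝ a) (LinearMap.ker_eq_bot.2 (mul_left_injective₀ ha))

theorem pairing_scaleSym (c : ℝ) (S : SymMat) (u w : Fin 4 → ℤ) :
    pairing (scaleSym c S) u w = c * pairing S u w := by
  simp only [pairing_eq_dotProduct, scaleSym, Matrix.vecMul_smul, smul_dotProduct, smul_eq_mul]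

theorem scaleSym_mem_reducedGram {c : ℝ} (hc : 0 < c) {S : SymMat} (hS : S ∈ reducedGram) :
    scaleSym c S ∈ reducedGram := by
  obtain ⟨S₀, ⟨v, hv, rfl⟩, U, hU, h⟩ := hS
  have ha : ((Real.sqrt c : ℝ) : ℍ) ≠ 0 := by
    rw [← Quaternion.coe_zero, Ne, Quaternion.coe_inj]
    exact (Real.sqrt_pos.2 hc).ne'
  refine ⟨scaleSym c (gramMat v), ⟨_, linearIndependent_mul_right hv ha, ?_⟩, U, ⟨fun u hu => ?_,
    fun k hk W hW => ?_, fun k => ?_⟩, ?_⟩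
  · rw [gramMat_mul_right, Quaternion.norm_coe, Real.norm_eq_abs, sq_abs, Real.sq_sqrt hc.le]
  · rw [pairing_scaleSym, pairing_scaleSym]
    exact mul_le_mul_of_nonneg_left (hU.first_row u hu) hc.le
  · rw [pairing_scaleSym, pairing_scaleSym]
    exact mul_le_mul_of_nonneg_left (hU.next_row k hk W hW) hc.le
  · rw [pairing_scaleSym]
    exact mul_nonneg hc.le (hU.sign k)
  · simp [scaleSym, h]

theorem scaleSym_mem_interior {c : ℝ} (hc : 0 < c) {S : SymMat}
    (hS : S ∈ interior reducedGram) : scaleSym c S ∈ interior reducedGram := by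
  refine mem_interior.2 ⟨scaleSym c⁻¹ ⁻¹' interior reducedGram, fun R hR => ?_,
    isOpen_interior.preimage (continuous_scaleSym _), ?_⟩
  · rw [← scaleSym_scaleSym_inv hc.ne' R]
    exact scaleSym_mem_reducedGram hc (interior_subset hR)
  · have := scaleSym_scaleSym_inv (inv_ne_zero hc.ne') S
    rw [inv_inv] at this
    rwa [Set.mem_preimage, this]

theorem mul_mem_latticeOf_mul_right {v : Fin 4 → ℍ} {a : ℍ} (ha : a ≠ 0) (q : ℍ) :
    q * a ∈ latticeOf (fun i => v i * a) ↔ q ∈ latticeOf v := by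
  rw [mem_latticeOf, mem_latticeOf]
  refine exists_congr fun c => ?_
  simp only [← smul_mul_assoc, ← Finset.sum_mul, mul_left_inj' ha]

/-- Right multiplication scales Gram matrices by a positive number, so it preserves tameness. -/
theorem IsTameBasis.mul_right {L L' : AddSubgroup ℍ} {v : Fin 4 → ℍ} (hv : IsTameBasis L v) {a : ℍ}
    (ha : a ≠ 0) (hL : ∀ q, q * a ∈ L' ↔ q ∈ L) : IsTameBasis L' fun i => v i * a := by
  have hint : gramMat (fun i => v i * a) ∈ interior reducedGram := by
    rw [gramMat_mul_right]
    exact scaleSym_mem_interior (by positivity) hv.2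
  refine ⟨⟨⟨linearIndependent_mul_right hv.1.1.1 ha, ?_⟩, interior_subset hint⟩, hint⟩
  ext q
  rw [← inv_mul_cancel_right₀ ha q, hL, ← hv.1.1.2]
  exact mul_mem_latticeOf_mul_right ha _

/-! ### Moduli of tame tori -/

theorem isRankFourLattice_modLattice {p : ℍ × ℍ × ℍ} (hp : p ∈ tameSet) :
    IsRankFourLattice (modLattice p) := ⟨_, hp.1.1.1⟩

theorem withOne_injective : Function.Injective withOne := fun p q h => by
  have h1 := congrFun h 1
  have h2 := congrFun h 2
  have h3 := congrFun h 3
  exact Prod.ext h1 (Prod.ext h2 h3)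

/-- A tame torus has a modulus in `𝓣`: normalise the first vector of a tame basis to `1`. -/
theorem IsTameTorus.exists_isModulus {L : AddSubgroup ℍ} (hL : IsRankFourLattice L)
    (h : IsTameTorus L) : ∃ p ∈ tameSet, IsModulus p L := by
  obtain ⟨L', ⟨v, hv⟩, hLL'⟩ := h
  have hv0 : (v 0)⁻¹ ≠ 0 := inv_ne_zero (hv.1.1.1.ne_zero 0)
  let p : ℍ × ℍ × ℍ := (v 1 * (v 0)⁻¹, v 2 * (v 0)⁻¹, v 3 * (v 0)⁻¹)
  have hp : withOne p = fun i => v i * (v 0)⁻¹ := by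
    ext1 i
    fin_cases i
    · exact (mul_inv_cancel₀ (hv.1.1.1.ne_zero 0)).symm
    · rfl
    · rfl
    · rfl
  have hsim : ∀ q, q * (v 0)⁻¹ ∈ modLattice p ↔ q ∈ L' := fun q => by
    rw [modLattice, hp, ← hv.1.1.2]
    exact mul_mem_latticeOf_mul_right hv0 q
  have htame : IsTameBasis (modLattice p) (withOne p) := by
    rw [hp]
    exact hv.mul_right hv0 hsim
  have hfund : p ∈ fundSet := ⟨htame.1, rfl⟩
  exact ⟨p, ⟨hfund, htame⟩, hfund,
    ((hLL'.rightSimilar hL ⟨v, hv.1.1⟩).trans ⟨_, hv0, hsim⟩).equivalentTori⟩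

/-- The sign left free by the uniqueness of tame bases is fixed by the common first vector `1`. -/
theorem eq_of_rightSimilar {p p' : ℍ × ℍ × ℍ} (hp : p ∈ tameSet) (hp' : p' ∈ tameSet)
    (h : RightSimilar (modLattice p) (modLattice p')) : p = p' := by
  obtain ⟨a, ha, h⟩ := h
  obtain ⟨ε, hε⟩ := (hp.2.mul_right ha h).exists_eq_smul hp'.2.1
  have h0 : (1 : ℍ) = (ε : ℤ) • (1 * a) := hε 0
  refine withOne_injective (funext fun i => ?_)
  rw [hε i, ← mul_smul_comm, ← one_mul a, ← h0, mul_one]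

theorem rightSimilar_of_isModulus {p : ℍ × ℍ × ℍ} (hp : p ∈ tameSet) {L : AddSubgroup ℍ}
    (hL : IsRankFourLattice L) (h : IsModulus p L) : RightSimilar L (modLattice p) :=
  h.2.rightSimilar hL (isRankFourLattice_modLattice hp)

end QTorus

/-- `𝓣 ⊆ 𝓜` is a moduli space for the equivalence classes of tame tori: the points of `𝓣`
are moduli of tame tori, every tame torus has exactly one modulus in `𝓣`, and two tame tori are
equivalent if and only if they have the same modulus in `𝓣`. -/
theorem mainTheorem4 :
    QTorus.tameSet ⊆ QTorus.fundSet ∧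
    (∀ p ∈ QTorus.tameSet, QTorus.IsTameTorus (QTorus.modLattice p)) ∧
    (∀ L : AddSubgroup ℍ, QTorus.IsRankFourLattice L → QTorus.IsTameTorus L →
      ∃! p : ℍ × ℍ × ℍ, p ∈ QTorus.tameSet ∧ QTorus.IsModulus p L) ∧
    (∀ L₁ L₂ : AddSubgroup ℍ, QTorus.IsRankFourLattice L₁ → QTorus.IsRankFourLattice L₂ →
      QTorus.IsTameTorus L₁ → QTorus.IsTameTorus L₂ →
      (QTorus.EquivalentTori L₁ L₂ ↔
        ∃ p ∈ QTorus.tameSet, QTorus.IsModulus p L₁ ∧ QTorus.IsModulus p L₂)) := by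
  refine ⟨fun p hp => hp.1, fun p hp => ?_, fun L hL hT => ?_, fun L₁ L₂ h₁ h₂ hT₁ hT₂ =>
    ⟨fun h => ?_, ?_⟩⟩
  · exact ⟨_, ⟨_, hp.2⟩, QTorus.RightSimilar.equivalentTori ⟨1, one_ne_zero, by simp⟩⟩
  · obtain ⟨p, hp, hm⟩ := hT.exists_isModulus hL
    refine ⟨p, ⟨hp, hm⟩, fun p' ⟨hp', hm'⟩ => ?_⟩
    exact QTorus.eq_of_rightSimilar hp' hp ((QTorus.rightSimilar_of_isModulus hp' hL hm').symm.trans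
      (QTorus.rightSimilar_of_isModulus hp hL hm))
  · obtain ⟨p, hp, hm⟩ := hT₁.exists_isModulus h₁
    exact ⟨p, hp, hm, hm.1, ((h.rightSimilar h₁ h₂).symm.trans
      (QTorus.rightSimilar_of_isModulus hp h₁ hm)).equivalentTori⟩
  · rintro ⟨p, hp, hm₁, hm₂⟩
    exact ((QTorus.rightSimilar_of_isModulus hp h₁ hm₁).trans
      (QTorus.rightSimilar_of_isModulus hp h₂ hm₂).symm).equivalentTori
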